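/- For an integer $n\ge 1$ and $q\in\mathbb{R}$, let $\mathrm{MK}(q)$ denote the unweighted minimum knapsack problem $$\min\ |\mathbf{x}|\quad\text{s.t.}\quad |\mathbf{x}|\ge q,\ \ \mathbf{x}\in\{0,1\}^n,\qquad |\mathbf{x}|:=\sum_{i=1}^n x_i .$$ For an integer $d\ge 0$, the degree-$d$ SOS program of $\mathrm{MK}(q)$ maximizes $\lambda\in\mathbb{R}$ subject to the existence of polynomials $s_0,s_1\in\mathbb{R}[x_1,\dots,x_n]$ that are sums of squares of polynomials, with $\deg s_0\le 2d+2$ and $\deg s_1\le 2d$, such that $$|\mathbf{x}|-\lambda=s_0(\mathbf{x})+s_1(\mathbf{x})\,(|\mathbf{x}|-q)\qquad\text{for all }\mathbf{x}\in\{0,1\}^n .$$ The program is exact if its maximum is attained and equals the optimal value of $\mathrm{MK}(q)$, and the SOS rank of $\mathrm{MK}(q)$ is the smallest $d\ge 0$ for which the degree-$d$ SOS program is exact. Write $\widehat q:=q-\lfloor q\rfloor$. If $0<q<\lfloor n/2\rfloor$ and $\widehat q\in(0,2^{-n}]$, then the SOS rank of $\mathrm{MK}(q)$ is $\Theta(n)$;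 that is, there are absolute constants $c,C>0$ such that, for all $n\ge 1$ and all such $q$, $$c\,n\ \le\ \mathrm{SOS}_{\mathrm{rk}}(\mathrm{MK}(q))\ \le\ C\,n .$$ -/

import Mathlib

/-- The Boolean hypercube `{0,1}^n`, as a set of real vectors. -/
def booleanCube (n : ℕ) : Set (Fin n → ℝ) :=
  {x | ∀ i, x i = 0 ∨ x i = 1}

/-- The feasible set of `MK(q)`: Boolean points with `∑ i, x i ≥ q`. -/
def mkFeasible (n : ℕ) (q : ℝ) : Set (Fin n → ℝ) :=
  {x | x ∈ booleanCube n ∧ q ≤ ∑ i, x i}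

/-- `v` is the optimal value of `MK(q)`: minimize `∑ i, x i` over the feasible set. -/
def IsMKOptimum (n : ℕ) (q v : ℝ) : Prop :=
  IsLeast ((fun x : Fin n → ℝ => ∑ i, x i) '' mkFeasible n q) v

/-- `s₀, s₁` is a degree-`d` SOS certificate over the hypercube of the lower bound `l` for
`MK(q)`: both are sums of squares of real polynomials, `deg s₀ ≤ 2d + 2`, `deg s₁ ≤ 2d`, and
`|x| - l = s₀(x) + s₁(x) (|x| - q)` for all `x ∈ {0,1}^n`. -/
def IsMKCertificate (n : ℕ) (q : ℝ) (d : ℕ) (l : ℝ) (s₀ s₁ : MvPolynomial (Fin n) ℝ) : Prop :=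
  IsSumSq s₀ ∧ IsSumSq s₁ ∧ s₀.totalDegree ≤ 2 * d + 2 ∧ s₁.totalDegree ≤ 2 * d ∧
    ∀ x ∈ booleanCube n,
      (∑ i, x i) - l =
        MvPolynomial.eval x s₀ + MvPolynomial.eval x s₁ * ((∑ i, x i) - q)

/-- The lower bounds certified by the degree-`d` SOS program of `MK(q)`. -/
def mkSOSBounds (n : ℕ) (q : ℝ) (d : ℕ) : Set ℝ :=
  {l | ∃ s₀ s₁ : MvPolynomial (Fin n) ℝ, IsMKCertificate n q d l s₀ s₁}

/-- The degree-`d` SOS program of `MK(q)` is exact: its maximum is the optimal value. -/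
def MKSOSExact (n : ℕ) (q : ℝ) (d : ℕ) : Prop :=
  ∃ v : ℝ, IsMKOptimum n q v ∧ IsGreatest (mkSOSBounds n q d) v

/-- The SOS rank of `MK(q)` in `n` variables: the least `d` for which the degree-`d` SOS
program is exact. (If no `d` were exact this would be `0`.) -/
noncomputable def mkSOSRank (n : ℕ) (q : ℝ) : ℕ :=
  sInf {d : ℕ | MKSOSExact n q d}

/-- The `0/1` indicator vector of a set of coordinates. -/
def cubePoint {n : ℕ} (A : Finset (Fin n)) : Fin n → ℝ :=
  fun i => if i ∈ A then 1 else 0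

lemma cubePoint_mem {n : ℕ} (A : Finset (Fin n)) : cubePoint A ∈ booleanCube n := by
  intro i
  by_cases h : i ∈ A <;> simp [cubePoint, h]

lemma sum_cubePoint {n : ℕ} (A : Finset (Fin n)) : ∑ i, cubePoint A i = (A.card : ℝ) := by
  simp [cubePoint]

lemma exists_eq_cubePoint {n : ℕ} {x : Fin n → ℝ} (hx : x ∈ booleanCube n) :
    ∃ A : Finset (Fin n), x = cubePoint A := by
  refine ⟨Finset.univ.filter fun i => x i = 1, ?_⟩
  ext i
  rcases hx i with h | h <;> simp [cubePoint, h]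

lemma IsSumSq.eval_nonneg {n : ℕ} {p : MvPolynomial (Fin n) ℝ} (hp : IsSumSq p)
    (x : Fin n → ℝ) : 0 ≤ MvPolynomial.eval x p := by
  induction hp with
  | zero => simp
  | sq_add a _ ih =>
    rw [map_add, map_mul]
    exact add_nonneg (mul_self_nonneg _) ih

/-- The alternating sum of a polynomial over a subcube of dimension exceeding its degree vanishes. -/
lemma sum_powerset_neg_one_pow_mul_eval_eq_zero {n : ℕ} (p : MvPolynomial (Fin n) ℝ)
    (A S : Finset (Fin n)) (hS : p.totalDegree < S.card) :
    ∑ T ∈ S.powerset, (-1 : ℝ) ^ T.card * MvPolynomial.eval (cubePoint (A ∪ T)) p = 0 := by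
  simp only [MvPolynomial.eval_eq, Finset.mul_sum]
  rw [Finset.sum_comm]
  refine Finset.sum_eq_zero fun m hm => ?_
  obtain ⟨i, hiS, him⟩ : ∃ i ∈ S, i ∉ m.support := by
    by_contra! h
    have h₁ : S.card ≤ m.support.card := Finset.card_le_card h
    have h₂ : m.support.card ≤ m.sum fun _ e => e := by
      rw [Finsupp.sum, Finset.card_eq_sum_ones]
      exact Finset.sum_le_sum fun j hj => Nat.one_le_iff_ne_zero.2 (Finsupp.mem_support_iff.1 hj)
    have h₃ := MvPolynomial.le_totalDegree hm
    omega
  rw [← Finset.insert_erase hiS, Finset.sum_powerset_insert (Finset.notMem_erase i S),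
    ← Finset.sum_add_distrib]
  refine Finset.sum_eq_zero fun T hT => ?_
  have hiT : i ∉ T := fun h => Finset.notMem_erase i S (Finset.mem_powerset.1 hT h)
  have hprod : ∏ j ∈ m.support, cubePoint (A ∪ insert i T) j ^ m j =
      ∏ j ∈ m.support, cubePoint (A ∪ T) j ^ m j := by
    refine Finset.prod_congr rfl fun j hj => ?_
    have hji : j ≠ i := fun h => him (h ▸ hj)
    simp [cubePoint, hji]
  rw [hprod, Finset.card_insert_of_notMem hiT, pow_succ]
  ring

/-- The polynomial that is `1` at `cubePoint A` and `0` at the other points of the cube. -/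
noncomputable def pointIndicator {n : ℕ} (A : Finset (Fin n)) : MvPolynomial (Fin n) ℝ :=
  ∏ i, if i ∈ A then MvPolynomial.X i else 1 - MvPolynomial.X i

lemma totalDegree_pointIndicator_le {n : ℕ} (A : Finset (Fin n)) :
    (pointIndicator A).totalDegree ≤ n := by
  refine (MvPolynomial.totalDegree_finsetProd _ _).trans ?_
  refine (Finset.sum_le_card_nsmul _ _ 1 fun i _ => ?_).trans (by simp)
  split_ifs
  · simp
  · exact (MvPolynomial.totalDegree_sub _ _).trans (by simp)

lemma eval_pointIndicator {n : ℕ} (A B : Finset (Fin n)) :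
    MvPolynomial.eval (cubePoint B) (pointIndicator A) = if A = B then 1 else 0 := by
  rw [pointIndicator, map_prod]
  split_ifs with h
  · subst h
    refine Finset.prod_eq_one fun i _ => ?_
    by_cases hi : i ∈ A <;> simp [cubePoint, hi]
  · obtain ⟨i, hi⟩ : ∃ i, ¬(i ∈ A ↔ i ∈ B) := by
      by_contra! h'
      exact h (Finset.ext h')
    refine Finset.prod_eq_zero (Finset.mem_univ i) ?_
    by_cases hA : i ∈ A <;> by_cases hB : i ∈ B <;> simp_all [cubePoint]

/-- Every nonnegative function on the cube is a sum of squares of polynomials of degree `n`. -/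
lemma exists_isSumSq_eval_eq {n : ℕ} (g : Finset (Fin n) → ℝ) (hg : ∀ A, 0 ≤ g A) :
    ∃ s : MvPolynomial (Fin n) ℝ, IsSumSq s ∧ s.totalDegree ≤ 2 * n ∧
      ∀ A, MvPolynomial.eval (cubePoint A) s = g A := by
  let r : Finset (Fin n) → MvPolynomial (Fin n) ℝ :=
    fun A => MvPolynomial.C (√(g A)) * pointIndicator A
  have hr : ∀ A, (r A).totalDegree ≤ n := fun A =>
    (MvPolynomial.totalDegree_mul _ _).trans
      (by simpa using totalDegree_pointIndicator_le A)
  refine ⟨∑ A, r A * r A, IsSumSq.sum_mul_self _ _, ?_, fun B => ?_⟩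
  · refine MvPolynomial.totalDegree_finsetSum_le fun A _ => ?_
    have h := MvPolynomial.totalDegree_mul (r A) (r A)
    have := hr A
    omega
  · simp [r, map_sum, eval_pointIndicator, Real.mul_self_sqrt (hg B)]

lemma isMKOptimum_floor_add_one {n m : ℕ} {q : ℝ} (hmn : m < n) (hmq : (m : ℝ) < q)
    (hqm : q < m + 1) : IsMKOptimum n q (m + 1) := by
  constructor
  · obtain ⟨A, -, hA⟩ := Finset.exists_subset_card_eq (s := (Finset.univ : Finset (Fin n)))
      (n := m + 1) (by simpa using hmn)
    have hs : ∑ i, cubePoint A i = (m : ℝ) + 1 := by rw [sum_cubePoint, hA]; push_cast; ring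
    exact ⟨cubePoint A, ⟨cubePoint_mem A, by rw [hs]; exact hqm.le⟩, hs⟩
  · rintro _ ⟨x, ⟨hx, hqx⟩, rfl⟩
    obtain ⟨A, rfl⟩ := exists_eq_cubePoint hx
    simp only [sum_cubePoint] at hqx ⊢
    have : m < A.card := by exact_mod_cast hmq.trans_le hqx
    exact_mod_cast this

lemma le_of_mem_mkSOSBounds {n d : ℕ} {q l v : ℝ} (hl : l ∈ mkSOSBounds n q d)
    (hv : IsMKOptimum n q v) : l ≤ v := by
  obtain ⟨s₀, s₁, h₀, h₁, -, -, h⟩ := hl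
  obtain ⟨x, ⟨hx, hqx⟩, rfl⟩ := hv.1
  have := h x hx
  have := mul_nonneg (h₁.eval_nonneg x) (sub_nonneg.2 hqx)
  have := h₀.eval_nonneg x
  simp only
  linarith

/-- The degree-`n` program is exact. -/
lemma mkSOSExact_self {n m : ℕ} {q : ℝ} (hmn : m < n) (hmq : (m : ℝ) < q) (hqm : q < m + 1) :
    MKSOSExact n q n := by
  have hopt := isMKOptimum_floor_add_one hmn hmq hqm
  refine ⟨m + 1, hopt, ?_, fun l hl => le_of_mem_mkSOSBounds hl hopt⟩
  have hcast : ∀ {k : ℕ}, k ≤ m → (k : ℝ) ≤ m := fun h => by exact_mod_cast h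
  obtain ⟨s₀, hs₀, hd₀, he₀⟩ := exists_isSumSq_eval_eq
    (fun A : Finset (Fin n) => if A.card ≤ m then 0 else (A.card : ℝ) - (m + 1)) fun A => by
      split_ifs with h
      · exact le_rfl
      · exact sub_nonneg.2 (by exact_mod_cast not_le.1 h)
  obtain ⟨s₁, hs₁, hd₁, he₁⟩ := exists_isSumSq_eval_eq
    (fun A : Finset (Fin n) => if A.card ≤ m then (m + 1 - (A.card : ℝ)) / (q - A.card) else 0)
    fun A => by
      split_ifs with h
      · have := hcast h
        exact div_nonneg (by linarith) (by linarith)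
      · exact le_rfl
  refine ⟨s₀, s₁, hs₀, hs₁, by omega, hd₁, fun x hx => ?_⟩
  obtain ⟨A, rfl⟩ := exists_eq_cubePoint hx
  rw [he₀, he₁, sum_cubePoint]
  split_ifs with h
  · have := hcast h
    have : q - A.card ≠ 0 := by linarith
    field_simp
    ring
  · ring

/-- An exact degree-`d` program forces `2d + 1 > n - ⌊q⌋` if `q` barely exceeds its floor. -/
lemma lt_two_mul_add_one_of_mem_mkSOSBounds {n m d : ℕ} {q : ℝ} (hmn : m < n)
    (hmq : (m : ℝ) < q) (hqm : q < m + 1) (hq : q - m ≤ ((2 : ℝ) ^ n)⁻¹)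
    (h : (m + 1 : ℝ) ∈ mkSOSBounds n q d) : n - m < 2 * d + 1 := by
  obtain ⟨s₀, s₁, hs₀, hs₁, -, hd₁, hc⟩ := h
  by_contra! hd
  obtain ⟨A, -, hA⟩ := Finset.exists_subset_card_eq (s := (Finset.univ : Finset (Fin n)))
    (n := m) (by simpa using hmn.le)
  obtain ⟨S, hSA, hS⟩ := Finset.exists_subset_card_eq (s := Aᶜ) (n := 2 * d + 1)
    (by rw [Finset.card_compl, hA, Fintype.card_fin]; exact hd)
  have hdisj : ∀ T ⊆ S, Disjoint A T := fun T hT =>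
    Finset.disjoint_left.2 fun i hi hiT => Finset.mem_compl.1 (hSA (hT hiT)) hi
  set f : Finset (Fin n) → ℝ := fun T => MvPolynomial.eval (cubePoint (A ∪ T)) s₁ with hf
  have hid : ∀ T ⊆ S, ((T.card : ℝ) - 1) =
      MvPolynomial.eval (cubePoint (A ∪ T)) s₀ + f T * (T.card - (q - m)) := fun T hT => by
    have := hc _ (cubePoint_mem (A ∪ T))
    rw [sum_cubePoint, Finset.card_union_of_disjoint (hdisj T hT), hA] at this
    push_cast at this
    linear_combination this
  have hf_nonneg : ∀ T, 0 ≤ f T := fun T => hs₁.eval_nonneg _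
  have hf_le : ∀ T ∈ S.powerset.erase ∅, f T ≤ 1 := fun T hT => by
    obtain ⟨hT0, hTS⟩ := Finset.mem_erase.1 hT
    have hT1 : (1 : ℝ) ≤ T.card := by
      exact_mod_cast Finset.card_pos.2 (Finset.nonempty_iff_ne_empty.2 hT0)
    have := hid T (Finset.mem_powerset.1 hTS)
    have := hs₀.eval_nonneg (cubePoint (A ∪ T))
    by_contra! hlt
    nlinarith
  have hf_empty : (2 : ℝ) ^ n ≤ f ∅ := by
    have h₁ := hid ∅ (Finset.empty_subset S)
    have h₂ := hs₀.eval_nonneg (cubePoint (A ∪ ∅))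
    simp only [Finset.card_empty, Nat.cast_zero] at h₁
    have h₃ : 1 ≤ f ∅ * (q - m) := by linarith
    have h₄ : f ∅ * (q - m) ≤ f ∅ * ((2 : ℝ) ^ n)⁻¹ :=
      mul_le_mul_of_nonneg_left hq (hf_nonneg ∅)
    rw [← div_eq_mul_inv] at h₄
    exact (one_le_div (by positivity)).1 (h₃.trans h₄)
  have hsum := sum_powerset_neg_one_pow_mul_eval_eq_zero s₁ A S (by omega)
  rw [← Finset.add_sum_erase _ _ (Finset.empty_mem_powerset S)] at hsum
  have hbound : -∑ T ∈ S.powerset.erase ∅, (-1 : ℝ) ^ T.card * f T ≤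
      ∑ T ∈ S.powerset.erase ∅, (1 : ℝ) := by
    rw [← Finset.sum_neg_distrib]
    refine Finset.sum_le_sum fun T hT => ?_
    have := hf_le T hT
    have := hf_nonneg T
    rcases neg_one_pow_eq_or ℝ T.card with h | h <;> rw [h] <;> linarith
  have hcard : (S.powerset.erase ∅).card < 2 ^ n := by
    have h₁ := Finset.card_erase_lt_of_mem (Finset.empty_mem_powerset S)
    rw [Finset.card_powerset, hS] at h₁
    exact h₁.trans_le (Nat.pow_le_pow_right two_pos (by omega))
  have hcard' : ((S.powerset.erase ∅).card : ℝ) < 2 ^ n := by exact_mod_cast hcard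
  rw [Finset.sum_const, nsmul_eq_mul, mul_one] at hbound
  simp only [Finset.card_empty, pow_zero, one_mul] at hsum
  simp only [hf] at hbound hf_empty
  linarith

theorem mainTheorem7 :
    ∃ c C : ℝ, 0 < c ∧ 0 < C ∧
      ∀ (n : ℕ) (q : ℝ), 0 < q → q < ((n / 2 : ℕ) : ℝ) →
        0 < Int.fract q → Int.fract q ≤ ((2 : ℝ) ^ n)⁻¹ →
          c * (n : ℝ) ≤ (mkSOSRank n q : ℝ) ∧ (mkSOSRank n q : ℝ) ≤ C * (n : ℝ) := by
  refine ⟨1 / 4, 1, by norm_num, one_pos, fun n q hq0 hqn hpos hsmall => ?_⟩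
  obtain ⟨m, hm⟩ : ∃ m : ℕ, ⌊q⌋ = m := Int.eq_ofNat_of_zero_le (Int.floor_nonneg.2 hq0.le)
  have hfract : Int.fract q = q - m := by rw [Int.fract, hm, Int.cast_natCast]
  have hlt := Int.fract_lt_one q
  rw [hfract] at hpos hsmall hlt
  have hmq : (m : ℝ) < q := by linarith
  have hqm : q < m + 1 := by linarith
  have hmn : m < n / 2 := by exact_mod_cast hmq.trans hqn
  have hexact := mkSOSExact_self (n := n) (by omega) hmq hqm
  refine ⟨?_, ?_⟩
  · obtain ⟨v, hv, hv'⟩ : MKSOSExact n q (mkSOSRank n q) :=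
      Nat.sInf_mem (s := {d | MKSOSExact n q d}) ⟨n, hexact⟩
    rw [hv.unique (isMKOptimum_floor_add_one (by omega) hmq hqm)] at hv'
    have h := lt_two_mul_add_one_of_mem_mkSOSBounds (by omega) hmq hqm hsmall hv'.1
    have h' : n ≤ 4 * mkSOSRank n q := by omega
    have h'' : (n : ℝ) ≤ 4 * mkSOSRank n q := by exact_mod_cast h'
    linarith
  · rw [one_mul]
    exact_mod_cast Nat.sInf_le (s := {d | MKSOSExact n q d}) hexact
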